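/- Let $\pi_1,\pi_2>0$, $\pi_3\in(-\pi_2,\pi_2)$, $n\ge 1$, $p\in\{1\}\cup[2,\infty)$, $A>0$, $\alpha\in(0,1)$ be real parameters and $\alpha_c=1-\alpha$. Consider the nondimensionalized Bouc-Wen-Maxwell collision model, i.e. the autonomous system $\dot{\mathbf X}=f(\mathbf X)$ for $\mathbf X=(R,Y,Z,W)\in\mathbb R^4$ with $$\begin{aligned} f_1(\mathbf X)&=\alpha\pi_1|Y|^{p-1}Y+\alpha_c\pi_1|Z|^{p-1}Z,\\ f_2(\mathbf X)&=W,\\ f_3(\mathbf X)&=A\left(W-\pi_2|Z|^{n-1}Z|W|-\pi_3|Z|^nW\right),\\ f_4(\mathbf X)&=-\tfrac1{\pi_1}f_1(\mathbf X)-\alpha p\pi_1|Y|^{p-1}f_2(\mathbf X)-\alpha_c p\pi_1|Z|^{p-1}f_3(\mathbf X) \end{aligned}$$ (where $0^0=1$) and arbitrary initial states in $\mathbb R^4$. Put $Q(\mathbf X)=f_1(\mathbf X)+W$ and $$\mathcal V(\mathbf X)=\left(R+\pi_1Q(\mathbf X)\right)^2+\frac{Q(\mathbf X)^2}{2}+\frac{\alpha}{p+1}|Y|^{p+1}+\frac{\alpha_c}{(p+1)A}|Z|^{p+1},$$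 $\mathcal S_{\mathbf Y}=\{\mathbf X\in\mathbb R^4:\mathcal V(\mathbf X)\le\mathcal V(\mathbf Y)\}$ for $\mathbf Y\in\mathbb R^4$, and $$\mathcal E=\left\{\left(R,\,Y,\,-(\alpha/\alpha_c)^{1/p}\,Y,\,0\right):R,Y\in\mathbb R\right\}.$$ A set $U\subseteq\mathbb R^4$ is called invariant if (i) every solution $\mathbf X:[0,\infty)\to\mathbb R^4$ with $\mathbf X(0)\in U$ satisfies $\mathbf X(t)\in U$ for all $t\ge0$, and (ii) for every $z\in U$ and $T\ge0$ there is a solution $\mathbf X:[0,T]\to U$ with $\mathbf X(T)=z$. For $\mathbf Y\in\mathbb R^4$, the positive limit set $\mathcal O^{+\infty}_{\mathbf Y}$ is the set of all $q\in\mathbb R^4$ for which there is a nondecreasing sequence $(t_k)$ of positive reals with $t_k\to+\infty$ and $\mathbf X(t_k)\to q$, where $\mathbf X:[0,\infty)\to\mathbb R^4$ is the solution with $\mathbf X(0)=\mathbf Y$. Proposition. Let $\mathbf X:[0,\infty)\to\mathbb R^4$ be a solution of the model with $\mathbf X(0)=\mathbf Y$. Then $\mathcal O^{+\infty}_{\mathbf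 Y}$ is a nonempty, connected, invariant set; $\mathbf X(t)$ converges to $\mathcal O^{+\infty}_{\mathbf Y}$ as $t\to+\infty$, i.e. for every $\varepsilon>0$ there is $T>0$ such that $\inf_{q\in\mathcal O^{+\infty}_{\mathbf Y}}\lVert\mathbf X(t)-q\rVert_2<\varepsilon$ for all $t>T$; and $\mathcal O^{+\infty}_{\mathbf Y}\subseteq\mathcal S_{\mathbf Y}\cap\mathcal E$. -/

import Mathlib

namespace BoucWenMaxwell

/-! ### Autonomous systems `ẋ = f(x)` on `ℝⁿ` -/

section Systems

variable {d : ℕ}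

/-- `x` is a solution of `ẋ = f(x)` on the interval `I` (one-sided derivatives at endpoints of `I`;
values of `x` outside `I` are irrelevant). -/
def IsSolutionOn (f : EuclideanSpace ℝ (Fin d) → EuclideanSpace ℝ (Fin d)) (I : Set ℝ)
    (x : ℝ → EuclideanSpace ℝ (Fin d)) : Prop :=
  ∀ t ∈ I, HasDerivWithinAt x (f (x t)) I t

/-- Every forward solution that starts in `U` stays in `U`. -/
def IsPositivelyInvariant (f : EuclideanSpace ℝ (Fin d) → EuclideanSpace ℝ (Fin d))
    (U : Set (EuclideanSpace ℝ (Fin d))) : Prop :=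
  ∀ x : ℝ → EuclideanSpace ℝ (Fin d), IsSolutionOn f (Set.Ici 0) x → x 0 ∈ U →
    ∀ t, 0 ≤ t → x t ∈ U

/-- For every `z ∈ U` and `T ≥ 0` there is a solution `[0, T] → U` that ends at `z`. -/
def IsNegativelyInvariant (f : EuclideanSpace ℝ (Fin d) → EuclideanSpace ℝ (Fin d))
    (U : Set (EuclideanSpace ℝ (Fin d))) : Prop :=
  ∀ z ∈ U, ∀ T : ℝ, 0 ≤ T → ∃ x : ℝ → EuclideanSpace ℝ (Fin d),
    IsSolutionOn f (Set.Icc 0 T) x ∧ (∀ t ∈ Set.Icc 0 T, x t ∈ U) ∧ x T = z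

/-- Positively and negatively invariant. -/
def IsInvariant (f : EuclideanSpace ℝ (Fin d) → EuclideanSpace ℝ (Fin d))
    (U : Set (EuclideanSpace ℝ (Fin d))) : Prop :=
  IsPositivelyInvariant f U ∧ IsNegativelyInvariant f U

/-- The positive limit set of the initial state `z`: all limits of `x (t k)` along nondecreasing
sequences of positive times `t k → +∞`, where `x` is the forward solution with `x 0 = z`. -/
def positiveLimitSet (f : EuclideanSpace ℝ (Fin d) → EuclideanSpace ℝ (Fin d))
    (z : EuclideanSpace ℝ (Fin d)) : Set (EuclideanSpace ℝ (Fin d)) :=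
  {q | ∃ x : ℝ → EuclideanSpace ℝ (Fin d), IsSolutionOn f (Set.Ici 0) x ∧ x 0 = z ∧
    ∃ t : ℕ → ℝ, Monotone t ∧ (∀ k, 0 < t k) ∧ Filter.Tendsto t Filter.atTop Filter.atTop ∧
      Filter.Tendsto (fun k => x (t k)) Filter.atTop (nhds q)}

/-- `x(t)` converges to the set `S` as `t → +∞`: for every `ε > 0` there is `T > 0` such that the
Euclidean distance from `x(t)` to `S` is less than `ε` for all `t > T`. (The extended distance
makes this fail for empty `S`.) -/
def ConvergesToSet (x : ℝ → EuclideanSpace ℝ (Fin d)) (S : Set (EuclideanSpace ℝ (Fin d))) :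
    Prop :=
  ∀ ε : ℝ, 0 < ε → ∃ T : ℝ, 0 < T ∧ ∀ t, T < t → Metric.infEDist (x t) S < ENNReal.ofReal ε

end Systems

/-! ### The nondimensionalized Bouc-Wen-Maxwell collision model -/

/-- The dimensionless parameters `(π₁, π₂, π₃, n, p, α, A)`. -/
structure Params where
  pi1 : ℝ
  pi2 : ℝ
  pi3 : ℝ
  n : ℝ
  p : ℝ
  α : ℝ
  A : ℝ

/-- The standing assumptions on the parameters. -/
structure Params.Admissible (P : Params) : Prop where
  pi1_pos : 0 < P.pi1
  pi2_pos : 0 < P.pi2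
  pi3_mem : P.pi3 ∈ Set.Ioo (-P.pi2) P.pi2
  one_le_n : 1 ≤ P.n
  p_cond : 2 ≤ P.p ∨ P.p = 1
  α_mem : P.α ∈ Set.Ioo (0 : ℝ) 1
  A_pos : 0 < P.A

noncomputable section

/-- `α_c = 1 - α`. -/
def Params.αc (P : Params) : ℝ := 1 - P.α

/-- Right-hand side of the equation for `R`, at `(R, Y, Z, W) = (X 0, X 1, X 2, X 3)`. -/
def f₁ (P : Params) (X : EuclideanSpace ℝ (Fin 4)) : ℝ :=
  P.α * P.pi1 * |X 1| ^ (P.p - 1) * X 1 + P.αc * P.pi1 * |X 2| ^ (P.p - 1) * X 2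

/-- Right-hand side of the equation for `Y`. -/
def f₂ (X : EuclideanSpace ℝ (Fin 4)) : ℝ := X 3

/-- Right-hand side of the equation for `Z`. -/
def f₃ (P : Params) (X : EuclideanSpace ℝ (Fin 4)) : ℝ :=
  P.A * (X 3 - P.pi2 * |X 2| ^ (P.n - 1) * X 2 * |X 3| - P.pi3 * |X 2| ^ P.n * X 3)

/-- Right-hand side of the equation for `W`. For `p = 1` the factors `|·| ^ (p - 1)` are `1`,
also at `0`. -/
def f₄ (P : Params) (X : EuclideanSpace ℝ (Fin 4)) : ℝ :=
  -(1 / P.pi1) * f₁ P X - P.α * P.p * P.pi1 * |X 1| ^ (P.p - 1) * f₂ X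
    - P.αc * P.p * P.pi1 * |X 2| ^ (P.p - 1) * f₃ P X

/-- The state function of the model. -/
def stateFun (P : Params) (X : EuclideanSpace ℝ (Fin 4)) : EuclideanSpace ℝ (Fin 4) :=
  !₂[f₁ P X, f₂ X, f₃ P X, f₄ P X]

/-- The second output `Q = Ṙ + Ẏ` of the model. -/
def Q (P : Params) (X : EuclideanSpace ℝ (Fin 4)) : ℝ :=
  P.α * P.pi1 * |X 1| ^ (P.p - 1) * X 1 + P.αc * P.pi1 * |X 2| ^ (P.p - 1) * X 2 + X 3

/-- The Lyapunov function. -/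
def lyapunov (P : Params) (X : EuclideanSpace ℝ (Fin 4)) : ℝ :=
  (X 0 + P.pi1 * Q P X) ^ 2 + Q P X ^ 2 / 2 + P.α / (P.p + 1) * |X 1| ^ (P.p + 1)
    + P.αc / ((P.p + 1) * P.A) * |X 2| ^ (P.p + 1)

/-- The Lyapunov sublevel set of the state `X`. -/
def sublevel (P : Params) (X : EuclideanSpace ℝ (Fin 4)) : Set (EuclideanSpace ℝ (Fin 4)) :=
  {X' | lyapunov P X' ≤ lyapunov P X}

/-- The set `{(R, Y, -(α / α_c) ^ (1 / p) * Y, 0) : R, Y ∈ ℝ}`. -/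
def equilibria (P : Params) : Set (EuclideanSpace ℝ (Fin 4)) :=
  {X | ∃ r y : ℝ, X = !₂[r, y, -(P.α / P.αc) ^ (1 / P.p) * y, 0]}

end

end BoucWenMaxwell

/-!
In the coordinates `(R + π₁ Q, Y, Z, Q)` the Lyapunov function `V` is a sum of powers of absolute
values, so its sublevel sets are compact. Along solutions its derivative is
`-f₁² / π₁ - α_c |Z| ^ (p - 1) Z h`, where `h = π₂ |Z| ^ (n - 1) Z |W| + π₃ |Z| ^ n W` is the
hysteretic part of the equation for `Z`; since `|π₃| ≤ π₂`, the product `|Z| ^ (p - 1) Z h` is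
nonnegative and `V` decreases. Trajectories are therefore bounded, so that the limit set is the set
of cluster points of the trajectory at infinity and limits of time translates of the trajectory are
solutions inside it, which gives connectedness, invariance and convergence.

`V` is constant on the limit set, so both terms of its derivative vanish along every solution in it:
`f₁ = 0` and `h = 0`. The first equation says `Z = -k Y` with `k = (α / α_c) ^ (1 / p)`, hence
`Ż = -k W`, while the second gives `Ż = A W`. As `A + k > 0`, this forces `W = 0`.
-/

open Set Filter Topology

namespace BoucWenMaxwell

section ClusterPoints

variable {α β : Type*} [TopologicalSpace α] {l : Filter β} {x : β → α} {K : Set α}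

theorem eventually_mem_of_mapClusterPt_subset (hK : IsCompact K) (hxK : ∀ᶠ b in l, x b ∈ K)
    {U : Set α} (hU : IsOpen U) (h : {q | MapClusterPt q l x} ⊆ U) : ∀ᶠ b in l, x b ∈ U := by
  by_contra hfreq
  obtain ⟨q, hqU, hq⟩ := (hK.diff hU).exists_mapClusterPt_of_frequently
    (((not_eventually.1 hfreq).and_eventually hxK).mono fun b hb => ⟨hb.2, hb.1⟩)
  exact hqU.2 (h hq)

theorem isConnected_setOf_mapClusterPt [T2Space α] [l.NeBot] {ι : Sort*} {p : ι → Prop}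
    {s : ι → Set β} (hl : l.HasBasis p s) (hs : ∀ i, p i → IsPreconnected (x '' s i))
    (hK : IsCompact K) (hxK : ∀ᶠ b in l, x b ∈ K) : IsConnected {q | MapClusterPt q l x} := by
  have hcompact : IsCompact {q | MapClusterPt q l x} :=
    hK.of_isClosed_subset isClosed_setOfPred_clusterPt
      fun q hq => hK.isClosed.mem_of_mapClusterPt hq hxK
  obtain ⟨q₀, -, hq₀⟩ := hK.exists_mapClusterPt_of_frequently hxK.frequently
  refine ⟨⟨q₀, hq₀⟩, isPreconnected_closed_iff.2 fun A B hA hB hAB hAne hBne => ?_⟩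
  by_contra hempty
  obtain ⟨U, W, hU, hW, hAU, hBW, hUW⟩ := SeparatedNhds.of_isCompact_isCompact
    (hcompact.inter_right hA) (hcompact.inter_right hB)
    (disjoint_left.2 fun q hqA hqB => hempty ⟨q, hqA.1, hqA.2, hqB.2⟩)
  have htail : ∀ᶠ b in l, x b ∈ U ∪ W :=
    eventually_mem_of_mapClusterPt_subset hK hxK (hU.union hW) fun q hq =>
      (hAB hq).imp (fun hqA => hAU ⟨hq, hqA⟩) (fun hqB => hBW ⟨hq, hqB⟩)
  obtain ⟨i, hi, hiUW⟩ := hl.eventually_iff.1 htail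
  have hvisits {q : α} {N : Set α} (hq : MapClusterPt q l x) (hN : IsOpen N) (hqN : q ∈ N) :
      (x '' s i ∩ N).Nonempty := by
    obtain ⟨b, hbN, hbs⟩ := ((hq.frequently (hN.mem_nhds hqN)).and_eventually
      (hl.mem_of_mem hi)).exists
    exact ⟨x b, mem_image_of_mem x hbs, hbN⟩
  obtain ⟨a, haA⟩ := hAne
  obtain ⟨b, hbB⟩ := hBne
  obtain ⟨z, -, hzU, hzW⟩ := hs i hi U W hU hW (image_subset_iff.2 fun c hc => hiUW hc)
    (hvisits haA.1 hU (hAU haA)) (hvisits hbB.1 hW (hBW hbB))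
  exact disjoint_left.1 hUW hzU hzW

theorem eq_of_mapClusterPt_atTop_of_antitoneOn [Preorder β] {γ : Type*} [TopologicalSpace γ]
    [PartialOrder γ] [OrderClosedTopology γ] {V : α → γ} (hV : Continuous V) {b₀ : β}
    (hVx : AntitoneOn (fun b => V (x b)) (Ici b₀)) {q r : α} (hq : MapClusterPt q atTop x)
    (hr : MapClusterPt r atTop x) : V q = V r := by
  have le_along {q : α} (hq : MapClusterPt q atTop x) {b : β} (hb : b₀ ≤ b) : V q ≤ V (x b) :=
    (isClosed_le hV continuous_const).mem_of_mapClusterPt hq <|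
      (eventually_ge_atTop b).mono fun c hc => hVx hb (hb.trans hc) hc
  have le_of_mapClusterPt {q r : α} (hq : MapClusterPt q atTop x) (hr : MapClusterPt r atTop x) :
      V q ≤ V r :=
    (isClosed_le continuous_const hV).mem_of_mapClusterPt hr <|
      (eventually_ge_atTop b₀).mono fun b hb => le_along hq hb
  exact (le_of_mapClusterPt hq hr).antisymm (le_of_mapClusterPt hr hq)

end ClusterPoints

/-! ### Positive limit sets of bounded trajectories -/

section LimitSets

variable {d : ℕ} {f : EuclideanSpace ℝ (Fin d) → EuclideanSpace ℝ (Fin d)}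
  {x y : ℝ → EuclideanSpace ℝ (Fin d)} {K : Set (EuclideanSpace ℝ (Fin d))}

theorem IsSolutionOn.continuousOn {I : Set ℝ} (hx : IsSolutionOn f I x) : ContinuousOn x I :=
  IsIntegralCurveOn.continuousOn hx

theorem IsSolutionOn.mono {I J : Set ℝ} (hx : IsSolutionOn f I x) (h : J ⊆ I) :
    IsSolutionOn f J x :=
  IsIntegralCurveOn.mono hx h

theorem IsSolutionOn.comp_add_const (hx : IsSolutionOn f (Ici 0) x) {τ : ℝ} (hτ : 0 ≤ τ) :
    IsSolutionOn f (Ici 0) fun t => x (t + τ) := by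
  refine IsIntegralCurveOn.mono (IsIntegralCurveOn.comp_add hx τ) fun t ht => ?_
  rw [mem_vadd_set_iff_neg_vadd_mem, neg_neg, vadd_eq_add]
  exact add_nonneg hτ ht

theorem IsSolutionOn.dist_le {L : NNReal} (hf : LipschitzOnWith L f K)
    (hx : IsSolutionOn f (Ici 0) x) (hy : IsSolutionOn f (Ici 0) y) {t : ℝ} (ht : 0 ≤ t)
    (hxK : MapsTo x (Icc 0 t) K) (hyK : MapsTo y (Icc 0 t) K) :
    dist (x t) (y t) ≤ dist (x 0) (y 0) * Real.exp (L * t) := by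
  have hright {z} (hz : IsSolutionOn f (Ici 0) z) (s) (hs : s ∈ Ico 0 t) :
      HasDerivWithinAt z (f (z s)) (Ici s) s :=
    (hz s hs.1).mono (Ici_subset_Ici.2 hs.1)
  simpa only [sub_zero] using
    dist_le_of_trajectories_ODE_of_mem (v := fun _ => f) (s := fun _ => K) (fun _ _ => hf)
      (hx.continuousOn.mono Icc_subset_Ici_self) (hright hx)
      (fun s hs => hxK (Ico_subset_Icc_self hs))
      (hy.continuousOn.mono Icc_subset_Ici_self) (hright hy)
      (fun s hs => hyK (Ico_subset_Icc_self hs)) le_rfl t (right_mem_Icc.2 ht)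

theorem IsSolutionOn.eqOn (hf : LocallyLipschitz f) (hx : IsSolutionOn f (Ici 0) x)
    (hy : IsSolutionOn f (Ici 0) y) (h0 : x 0 = y 0) : EqOn x y (Ici 0) := by
  intro t ht
  have himage {z} (hz : IsSolutionOn f (Ici 0) z) : IsCompact (z '' Icc 0 t) :=
    isCompact_Icc.image_of_continuousOn (hz.continuousOn.mono Icc_subset_Ici_self)
  obtain ⟨L, hL⟩ := hf.locallyLipschitzOn.exists_lipschitzOnWith_of_compact
    ((himage hx).union (himage hy))
  have hdist := hx.dist_le hL hy ht (fun s hs => .inl ⟨s, hs, rfl⟩) (fun s hs => .inr ⟨s, hs, rfl⟩)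
  rw [h0, dist_self, zero_mul] at hdist
  exact dist_le_zero.1 hdist

theorem isSolutionOn_Ici_iff_integral_eq (hf : Continuous f) :
    IsSolutionOn f (Ici 0) x ↔
      ContinuousOn x (Ici 0) ∧ ∀ t, 0 ≤ t → x 0 + ∫ s in (0 : ℝ)..t, f (x s) = x t := by
  have hf' (S) : ContinuousOn (Function.uncurry fun _ : ℝ => f) (S ×ˢ univ) :=
    (hf.comp continuous_snd).continuousOn
  refine ⟨fun hx => ⟨hx.continuousOn, fun t ht => ?_⟩, fun ⟨hcont, hint⟩ t ht => ?_⟩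
  · have hIci : uIcc 0 t ⊆ Ici 0 := by simpa only [uIcc_of_le ht] using Icc_subset_Ici_self
    exact ODE.picard_eq_of_hasDerivAt (hf' _) (hx.mono hIci) (mapsTo_univ _ _)
  · have hmem : t ∈ Icc 0 (t + 1) := ⟨ht, by linarith⟩
    have hderiv := ODE.hasDerivWithinAt_picard_Icc (left_mem_Icc.2 (hmem.1.trans hmem.2)) (hf' _)
      (hcont.mono Icc_subset_Ici_self) (fun _ _ => mem_univ _) (x 0) hmem
    have hnhds : Icc 0 (t + 1) ∈ 𝓝[Ici 0] t :=
      mem_nhdsWithin.2 ⟨Iio (t + 1), isOpen_Iio, lt_add_one t, fun s hs => ⟨hs.2, hs.1.le⟩⟩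
    exact (hderiv.mono_of_mem_nhdsWithin hnhds).congr (fun s hs => (hint s hs).symm)
      (hint t ht).symm

theorem IsSolutionOn.lipschitzOnWith {C : NNReal} (hx : IsSolutionOn f (Ici 0) x)
    (hC : ∀ t, 0 ≤ t → ‖f (x t)‖₊ ≤ C) : LipschitzOnWith C x (Ici 0) :=
  (convex_Ici 0).lipschitzOnWith_of_nnnorm_hasDerivWithin_le hx hC

section Limits

variable {ι : Type*} {l : Filter ι} [l.NeBot] {u : ι → ℝ → EuclideanSpace ℝ (Fin d)}

theorem isSolutionOn_of_tendsto [l.IsCountablyGenerated] (hf : Continuous f) (hK : IsCompact K)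
    (hu : ∀ᶠ k in l, IsSolutionOn f (Ici 0) (u k) ∧ MapsTo (u k) (Ici 0) K)
    (hlim : ∀ t, 0 ≤ t → Tendsto (u · t) l (𝓝 (x t))) : IsSolutionOn f (Ici 0) x := by
  obtain ⟨C, hC⟩ := hK.exists_bound_of_continuousOn hf.continuousOn
  have hlip : LipschitzOnWith C.toNNReal x (Ici 0) :=
    LipschitzOnWith.of_dist_le_mul fun s hs t ht =>
      le_of_tendsto ((hlim s hs).dist (hlim t ht)) <| hu.mono fun k ⟨hsol, hmaps⟩ =>
        (hsol.lipschitzOnWith fun r hr =>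
          NNReal.le_toNNReal_of_coe_le (hC _ (hmaps hr))).dist_le_mul s hs t ht
  refine (isSolutionOn_Ici_iff_integral_eq hf).2 ⟨hlip.continuousOn, fun t ht => ?_⟩
  have hpos {s} (hs : s ∈ uIoc 0 t) : 0 ≤ s := by
    rw [uIoc_of_le ht] at hs
    exact hs.1.le
  have hint : Tendsto (fun k => ∫ s in (0 : ℝ)..t, f (u k s)) l
      (𝓝 (∫ s in (0 : ℝ)..t, f (x s))) := by
    refine intervalIntegral.tendsto_integral_filter_of_dominated_convergence (fun _ => C)
      (hu.mono fun k hk => ?_)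
      (hu.mono fun k hk => .of_forall fun s hs => hC _ (hk.2 (hpos hs)))
      intervalIntegrable_const
      (.of_forall fun s hs => (hf.tendsto _).comp (hlim s (hpos hs)))
    exact (hf.comp_continuousOn (hk.1.continuousOn.mono fun s => hpos)).aestronglyMeasurable
      measurableSet_uIoc
  refine tendsto_nhds_unique (((hlim 0 le_rfl).add hint).congr' ?_) (hlim t ht)
  exact hu.mono fun k hk => ((isSolutionOn_Ici_iff_integral_eq hf).1 hk.1).2 t ht

theorem exists_tendsto_of_tendsto_initial (hf : LocallyLipschitz f) (hK : IsCompact K)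
    (hu : ∀ᶠ k in l, IsSolutionOn f (Ici 0) (u k) ∧ MapsTo (u k) (Ici 0) K)
    {q : EuclideanSpace ℝ (Fin d)} (hq : Tendsto (u · 0) l (𝓝 q)) {t : ℝ} (ht : 0 ≤ t) :
    ∃ z, Tendsto (u · t) l (𝓝 z) := by
  obtain ⟨L, hL⟩ := hf.locallyLipschitzOn.exists_lipschitzOnWith_of_compact hK
  have hcauchy : Tendsto (fun k : ι × ι => dist (u k.1 0) (u k.2 0)) (l ×ˢ l) (𝓝 0) :=
    tendsto_uniformity_iff_dist_tendsto_zero.1 (cauchy_map_iff'.1 hq.cauchy_map)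
  refine cauchy_map_iff_exists_tendsto.1 <|
    cauchy_map_iff'.2 <| tendsto_uniformity_iff_dist_tendsto_zero.2 <|
      squeeze_zero' (.of_forall fun _ => dist_nonneg) ?_
        (by simpa only [zero_mul] using hcauchy.mul_const (Real.exp (L * t)))
  filter_upwards [hu.prod_mk hu] with k ⟨⟨hsol₁, hmaps₁⟩, hsol₂, hmaps₂⟩
  exact hsol₁.dist_le hL hsol₂ ht (hmaps₁.mono_left Icc_subset_Ici_self)
    (hmaps₂.mono_left Icc_subset_Ici_self)

end Limits

theorem positiveLimitSet_eq_setOf_mapClusterPt (hf : LocallyLipschitz f)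
    (hx : IsSolutionOn f (Ici 0) x) :
    positiveLimitSet f (x 0) = {q | MapClusterPt q atTop x} := by
  ext q
  constructor
  · rintro ⟨y, hy, hy0, t, -, htpos, ht, hq⟩
    have hxq : Tendsto (x ∘ t) atTop (𝓝 q) :=
      hq.congr fun k => hy.eqOn hf hx hy0 (htpos k).le
    exact hxq.mapClusterPt.of_comp ht
  · intro hq
    obtain ⟨t, hxq, ht⟩ := MapClusterPt.exists_seq_tendsto hq
    obtain ⟨N, hN⟩ := eventually_atTop.1 (ht.eventually_gt_atTop 0)
    have hshift := tendsto_add_atTop_nat N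
    obtain ⟨φ, hφ, hmono⟩ := strictMono_subseq_of_tendsto_atTop (ht.comp hshift)
    have hφ' := hshift.comp hφ.tendsto_atTop
    exact ⟨x, hx, rfl, fun k => t (φ k + N), hmono.monotone, fun k => hN _ (Nat.le_add_left N _),
      ht.comp hφ', hxq.comp hφ'⟩

theorem positiveLimitSet_subset (hf : LocallyLipschitz f) (hx : IsSolutionOn f (Ici 0) x)
    (hK : IsClosed K) (hxK : MapsTo x (Ici 0) K) : positiveLimitSet f (x 0) ⊆ K := by
  rw [positiveLimitSet_eq_setOf_mapClusterPt hf hx]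
  exact fun q hq => hK.mem_of_mapClusterPt hq ((eventually_ge_atTop 0).mono hxK)

section Bounded

variable (hf : LocallyLipschitz f) (hx : IsSolutionOn f (Ici 0) x) (hK : IsCompact K)
  (hxK : MapsTo x (Ici 0) K)
include hf hx hK hxK

theorem isConnected_positiveLimitSet : IsConnected (positiveLimitSet f (x 0)) := by
  rw [positiveLimitSet_eq_setOf_mapClusterPt hf hx]
  refine isConnected_setOf_mapClusterPt (atTop_basis' 0) (fun a ha => ?_) hK
    ((eventually_ge_atTop 0).mono hxK)
  exact isPreconnected_Ici.image x (hx.continuousOn.mono (Ici_subset_Ici.2 ha))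

theorem convergesToSet_positiveLimitSet : ConvergesToSet x (positiveLimitSet f (x 0)) := by
  intro ε hε
  have hev : ∀ᶠ t in atTop, x t ∈ Metric.thickening ε (positiveLimitSet f (x 0)) := by
    refine eventually_mem_of_mapClusterPt_subset hK ((eventually_ge_atTop 0).mono hxK)
      Metric.isOpen_thickening ?_
    rw [← positiveLimitSet_eq_setOf_mapClusterPt hf hx]
    exact Metric.self_subset_thickening hε _
  obtain ⟨T, hT, hball⟩ := (atTop_basis' (1 : ℝ)).eventually_iff.1 hev
  exact ⟨T, zero_lt_one.trans_le hT, fun t ht => hball (mem_Ici.2 ht.le)⟩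

theorem exists_solution_in_positiveLimitSet_through {q : EuclideanSpace ℝ (Fin d)}
    (hq : q ∈ positiveLimitSet f (x 0)) {T : ℝ} (hT : 0 ≤ T) :
    ∃ y, IsSolutionOn f (Ici 0) y ∧ y T = q ∧ MapsTo y (Ici 0) (positiveLimitSet f (x 0)) := by
  have hΛ := positiveLimitSet_eq_setOf_mapClusterPt hf hx
  obtain ⟨τ, hτq, hτ⟩ := MapClusterPt.exists_seq_tendsto (hΛ ▸ hq)
  have hσ : Tendsto (fun k => τ k - T) atTop atTop := tendsto_atTop_add_const_right _ (-T) hτ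
  obtain ⟨q₀, -, φ, hφ, hq₀⟩ := hK.tendsto_subseq'
    ((hσ.eventually_ge_atTop 0).mono fun k hk => hxK hk).frequently
  have hσφ := hσ.comp hφ.tendsto_atTop
  have htranslates : ∀ᶠ k in atTop, IsSolutionOn f (Ici 0) (fun t => x (t + (τ (φ k) - T))) ∧
      MapsTo (fun t => x (t + (τ (φ k) - T))) (Ici 0) K :=
    (hσφ.eventually_ge_atTop 0).mono fun k hk =>
      ⟨hx.comp_add_const hk, fun t ht => hxK (add_nonneg ht hk)⟩
  choose! y hy using fun t (ht : 0 ≤ t) => exists_tendsto_of_tendsto_initial hf hK htranslates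
    (by simpa only [Function.comp_def, zero_add] using hq₀) ht
  refine ⟨y, isSolutionOn_of_tendsto hf.continuous hK htranslates hy, ?_, fun t ht => ?_⟩
  · refine tendsto_nhds_unique (hy T hT) ?_
    simpa only [Function.comp_def, add_sub_cancel] using hτq.comp hφ.tendsto_atTop
  · rw [hΛ]
    exact (hy t ht).mapClusterPt.of_comp (tendsto_atTop_add_const_left _ t hσφ)

theorem isInvariant_positiveLimitSet : IsInvariant f (positiveLimitSet f (x 0)) := by
  refine ⟨fun y hy hy0 t ht => ?_, fun q hq T hT => ?_⟩
  · obtain ⟨z, hz, hz0, hmaps⟩ :=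
      exists_solution_in_positiveLimitSet_through hf hx hK hxK hy0 le_rfl
    rw [hy.eqOn hf hz hz0.symm ht]
    exact hmaps ht
  · obtain ⟨y, hy, hyT, hmaps⟩ := exists_solution_in_positiveLimitSet_through hf hx hK hxK hq hT
    exact ⟨y, hy.mono Icc_subset_Ici_self, fun t ht => hmaps ht.1, hyT⟩

theorem exists_solution_const_of_antitoneOn {γ : Type*} [TopologicalSpace γ] [PartialOrder γ]
    [OrderClosedTopology γ] {V : EuclideanSpace ℝ (Fin d) → γ}
    (hV : Continuous V) (hVx : AntitoneOn (fun t => V (x t)) (Ici 0))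
    {q : EuclideanSpace ℝ (Fin d)} (hq : q ∈ positiveLimitSet f (x 0)) :
    ∃ y, IsSolutionOn f (Ici 0) y ∧ y 0 = q ∧ ∀ t, 0 ≤ t → V (y t) = V q := by
  obtain ⟨y, hy, hy0, hmaps⟩ :=
    exists_solution_in_positiveLimitSet_through hf hx hK hxK hq le_rfl
  rw [positiveLimitSet_eq_setOf_mapClusterPt hf hx] at hq hmaps
  exact ⟨y, hy, hy0, fun t ht => eq_of_mapClusterPt_atTop_of_antitoneOn hV hVx (hmaps ht) hq⟩

end Bounded

end LimitSets

/-! ### Signed powers -/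

section SignedPowers

/-- The odd extension `x ↦ sign(x) |x| ^ a` of the power function, written as in the model so that
the factor `|x| ^ (a - 1)` is `1` for `a = 1`, also at `x = 0`. -/
noncomputable def signedRpow (a x : ℝ) : ℝ :=
  |x| ^ (a - 1) * x

variable {a : ℝ}

theorem abs_signedRpow (ha : a ≠ 0) (x : ℝ) : |signedRpow a x| = |x| ^ a := by
  rw [signedRpow, abs_mul, abs_of_nonneg (by positivity)]
  rcases eq_or_ne x 0 with rfl | hx
  · simp [Real.zero_rpow ha]
  · rw [← Real.rpow_add_one (abs_ne_zero.2 hx), sub_add_cancel]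

theorem signedRpow_of_nonneg (ha : a ≠ 0) {x : ℝ} (hx : 0 ≤ x) : signedRpow a x = x ^ a := by
  have hnonneg : 0 ≤ signedRpow a x := mul_nonneg (by positivity) hx
  rw [← abs_of_nonneg hnonneg, abs_signedRpow ha, abs_of_nonneg hx]

theorem signedRpow_neg (a x : ℝ) : signedRpow a (-x) = -signedRpow a x := by
  rw [signedRpow, signedRpow, abs_neg, mul_neg]

theorem signedRpow_mul (a x y : ℝ) : signedRpow a (x * y) = signedRpow a x * signedRpow a y := by
  simp only [signedRpow, abs_mul, Real.mul_rpow (abs_nonneg x) (abs_nonneg y)]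
  ring

theorem signedRpow_injective (ha : a ≠ 0) : Function.Injective (signedRpow a) := by
  intro x y hxy
  have habs : |x| = |y| :=
    (Real.rpow_left_inj (abs_nonneg x) (abs_nonneg y) ha).1 <| by
      rw [← abs_signedRpow ha, ← abs_signedRpow ha, hxy]
  rcases eq_or_ne y 0 with rfl | hy
  · simpa only [abs_zero, abs_eq_zero] using habs
  · rw [signedRpow, signedRpow, habs] at hxy
    exact mul_left_cancel₀ (Real.rpow_pos_of_pos (abs_pos.2 hy) _).ne' hxy

theorem signedRpow_mul_signedRpow_nonneg (a b x : ℝ) : 0 ≤ signedRpow a x * signedRpow b x := by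
  rw [signedRpow, signedRpow, mul_mul_mul_comm]
  exact mul_nonneg (by positivity) (mul_self_nonneg x)

theorem continuous_abs_rpow (ha : 0 ≤ a) : Continuous fun x : ℝ => |x| ^ a :=
  continuous_abs.rpow_const fun _ => .inr ha

theorem continuous_signedRpow (ha : 1 ≤ a) : Continuous (signedRpow a) :=
  (continuous_abs_rpow (sub_nonneg.2 ha)).mul continuous_id

theorem hasDerivAt_signedRpow (ha : 1 ≤ a) (x : ℝ) :
    HasDerivAt (signedRpow a) (a * |x| ^ (a - 1)) x := by
  refine hasDerivAt_of_hasDerivAt_of_ne' (x := 0) (g := fun y => a * |y| ^ (a - 1)) (fun y hy => ?_)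
    (continuous_signedRpow ha).continuousAt
    (continuous_const.mul (continuous_abs_rpow (sub_nonneg.2 ha))).continuousAt x
  have hpow := (hasDerivAt_abs hy).rpow_const (p := a - 1) (.inl (abs_ne_zero.2 hy))
  refine (hpow.mul (hasDerivAt_id y)).congr_deriv ?_
  have hsign : (SignType.sign y : ℝ) * y = |y| := sign_mul_self y
  have hrpow : |y| ^ (a - 1 - 1) * |y| = |y| ^ (a - 1) := by
    rw [← Real.rpow_add_one (abs_ne_zero.2 hy), sub_add_cancel]
  simp only [id_eq, mul_one]
  linear_combination (a - 1) * |y| ^ (a - 1 - 1) * hsign + (a - 1) * hrpow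

theorem hasDerivAt_abs_rpow_add_one (ha : 0 < a) (x : ℝ) :
    HasDerivAt (fun x : ℝ => |x| ^ (a + 1)) ((a + 1) * signedRpow a x) x := by
  refine (hasDerivAt_abs_rpow x (lt_add_of_pos_left 1 ha)).congr_deriv ?_
  rw [signedRpow, mul_assoc, show a + 1 - 2 = a - 1 by ring]

theorem locallyLipschitz_signedRpow (ha : 1 ≤ a) : LocallyLipschitz (signedRpow a) := by
  refine ContDiff.locallyLipschitz (𝕂 := ℝ) (contDiff_one_iff_deriv.2
    ⟨fun x => (hasDerivAt_signedRpow ha x).differentiableAt, ?_⟩)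
  rw [deriv_eq (hasDerivAt_signedRpow ha)]
  exact continuous_const.mul (continuous_abs_rpow (sub_nonneg.2 ha))

theorem locallyLipschitz_abs_rpow (ha : 1 ≤ a) : LocallyLipschitz fun x : ℝ => |x| ^ a :=
  (Real.contDiff_rpow_const_of_le (n := 1) (by simpa using ha)).locallyLipschitz.comp
    lipschitzWith_one_norm.locallyLipschitz

theorem isCompact_setOf_mul_abs_rpow_le {r : ℝ} (ha : 0 < a) (hr : 0 < r) (c : ℝ) :
    IsCompact {x : ℝ | a * |x| ^ r ≤ c} := by
  refine (isCompact_closedBall (0 : ℝ) ((c / a) ^ r⁻¹)).of_isClosed_subset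
    (isClosed_le (continuous_const.mul (continuous_abs_rpow hr.le)) continuous_const) fun x hx => ?_
  have hpow : |x| ^ r ≤ c / a := (le_div_iff₀' ha).2 hx
  rw [mem_closedBall_zero_iff, Real.norm_eq_abs]
  exact (Real.le_rpow_inv_iff_of_pos (abs_nonneg x) ((by positivity : 0 ≤ |x| ^ r).trans hpow)
    hr).2 hpow

end SignedPowers

section LocallyLipschitzMaps

variable {α : Type*} [PseudoEMetricSpace α]

theorem locallyLipschitz_mul {R : Type*} [NormedRing R] [NormedAlgebra ℝ R] {g h : α → R}
    (hg : LocallyLipschitz g) (hh : LocallyLipschitz h) : LocallyLipschitz fun x => g x * h x :=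
  (contDiff_mul (𝕜 := ℝ) (n := 1)).locallyLipschitz.comp (hg.prodMk hh)

theorem locallyLipschitz_pi {ι : Type*} [Fintype ι] {β : ι → Type*}
    [∀ i, PseudoEMetricSpace (β i)] {g : α → ∀ i, β i}
    (hg : ∀ i, LocallyLipschitz fun x => g x i) : LocallyLipschitz g := by
  intro x
  choose C s hs hC using fun i => hg i x
  refine ⟨Finset.univ.sup C, ⋂ i, s i, iInter_mem.2 hs, fun y hy z hz =>
    edist_pi_le_iff.2 fun i => ?_⟩
  refine (hC i (mem_iInter.1 hy i) (mem_iInter.1 hz i)).trans ?_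
  gcongr
  exact Finset.le_sup (Finset.mem_univ i)

end LocallyLipschitzMaps

/-! ### The Lyapunov function of the model -/

section Model

variable {P : Params}

/-- The hysteretic part `π₂ |Z| ^ (n - 1) Z |W| + π₃ |Z| ^ n W` of the right-hand side of the
equation for `Z`. -/
noncomputable def hysteresis (P : Params) (X : EuclideanSpace ℝ (Fin 4)) : ℝ :=
  P.pi2 * signedRpow P.n (X 2) * |X 3| + P.pi3 * |X 2| ^ P.n * X 3

/-- The orbital derivative of the Lyapunov function. -/
noncomputable def lyapunovRate (P : Params) (X : EuclideanSpace ℝ (Fin 4)) : ℝ :=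
  -(f₁ P X ^ 2 / P.pi1) - P.αc * (signedRpow P.p (X 2) * hysteresis P X)

theorem f₁_eq (P : Params) (X : EuclideanSpace ℝ (Fin 4)) :
    f₁ P X = P.pi1 * (P.α * signedRpow P.p (X 1) + P.αc * signedRpow P.p (X 2)) := by
  simp only [f₁, signedRpow]
  ring

theorem f₃_eq (P : Params) (X : EuclideanSpace ℝ (Fin 4)) :
    f₃ P X = P.A * (X 3 - hysteresis P X) := by
  simp only [f₃, hysteresis, signedRpow]
  ring

theorem f₄_eq (P : Params) (X : EuclideanSpace ℝ (Fin 4)) :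
    f₄ P X = -(1 / P.pi1) * f₁ P X - P.pi1 * (P.α * (P.p * |X 1| ^ (P.p - 1) * X 3)
      + P.αc * (P.p * |X 2| ^ (P.p - 1) * f₃ P X)) := by
  simp only [f₄, f₂]
  ring

theorem Q_eq (P : Params) (X : EuclideanSpace ℝ (Fin 4)) : Q P X = f₁ P X + X 3 :=
  rfl

theorem locallyLipschitz_coord {ι : Type*} [Fintype ι] (i : ι) :
    LocallyLipschitz fun X : EuclideanSpace ℝ ι => X i :=
  (EuclideanSpace.proj (𝕜 := ℝ) i).lipschitz.locallyLipschitz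

theorem locallyLipschitz_f₁ (hp : 1 ≤ P.p) : LocallyLipschitz (f₁ P) := by
  have hspring (i) : LocallyLipschitz fun X : EuclideanSpace ℝ (Fin 4) => signedRpow P.p (X i) :=
    (locallyLipschitz_signedRpow hp).comp (locallyLipschitz_coord i)
  rw [funext (f₁_eq P)]
  exact locallyLipschitz_mul (.const _) ((locallyLipschitz_mul (.const _) (hspring 1)).add
    (locallyLipschitz_mul (.const _) (hspring 2)))

theorem locallyLipschitz_hysteresis (hn : 1 ≤ P.n) : LocallyLipschitz (hysteresis P) := by
  have hZ := locallyLipschitz_coord (2 : Fin 4)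
  have hW := locallyLipschitz_coord (3 : Fin 4)
  have habsW : LocallyLipschitz fun X : EuclideanSpace ℝ (Fin 4) => |X 3| :=
    lipschitzWith_one_norm.locallyLipschitz.comp hW
  exact (locallyLipschitz_mul (locallyLipschitz_mul (.const _)
    ((locallyLipschitz_signedRpow hn).comp hZ)) habsW).add (locallyLipschitz_mul
      (locallyLipschitz_mul (.const _) ((locallyLipschitz_abs_rpow hn).comp hZ)) hW)

theorem locallyLipschitz_f₃ (hn : 1 ≤ P.n) : LocallyLipschitz (f₃ P) := by
  rw [funext (f₃_eq P)]
  exact locallyLipschitz_mul (.const _)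
    ((locallyLipschitz_coord 3).sub (locallyLipschitz_hysteresis hn))

theorem locallyLipschitz_f₄ (hn : 1 ≤ P.n) (hp : 2 ≤ P.p ∨ P.p = 1) :
    LocallyLipschitz (f₄ P) := by
  have hp1 : 1 ≤ P.p := hp.elim one_le_two.trans Eq.ge
  have hpow : LocallyLipschitz fun x : ℝ => |x| ^ (P.p - 1) := by
    rcases hp with hp | hp
    · exact locallyLipschitz_abs_rpow (by linarith)
    · simpa only [hp, sub_self, Real.rpow_zero] using LocallyLipschitz.const (1 : ℝ)
  have hstiffness (i) :
      LocallyLipschitz fun X : EuclideanSpace ℝ (Fin 4) => P.p * |X i| ^ (P.p - 1) :=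
    locallyLipschitz_mul (.const _) (hpow.comp (locallyLipschitz_coord i))
  rw [funext (f₄_eq P)]
  exact (locallyLipschitz_mul (.const _) (locallyLipschitz_f₁ hp1)).sub
    (locallyLipschitz_mul (.const _) ((locallyLipschitz_mul (.const _)
      (locallyLipschitz_mul (hstiffness 1) (locallyLipschitz_coord 3))).add
        (locallyLipschitz_mul (.const _)
          (locallyLipschitz_mul (hstiffness 2) (locallyLipschitz_f₃ hn)))))

theorem locallyLipschitz_stateFun (hn : 1 ≤ P.n) (hp : 2 ≤ P.p ∨ P.p = 1) :
    LocallyLipschitz (stateFun P) := by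
  refine (PiLp.lipschitzWith_toLp 2 _).locallyLipschitz.comp (locallyLipschitz_pi fun i => ?_)
  fin_cases i
  · exact locallyLipschitz_f₁ (hp.elim one_le_two.trans Eq.ge)
  · exact locallyLipschitz_coord 3
  · exact locallyLipschitz_f₃ hn
  · exact locallyLipschitz_f₄ hn hp

theorem continuous_Q (hp : 1 ≤ P.p) : Continuous (Q P) :=
  ((locallyLipschitz_f₁ hp).add (locallyLipschitz_coord 3)).continuous

theorem continuous_lyapunov (hp : 1 ≤ P.p) : Continuous (lyapunov P) := by
  have hQ := continuous_Q hp
  have hpow : Continuous fun x : ℝ => |x| ^ (P.p + 1) := continuous_abs_rpow (by linarith)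
  have henergy (i) : Continuous fun X : EuclideanSpace ℝ (Fin 4) => |X i| ^ (P.p + 1) :=
    hpow.comp (locallyLipschitz_coord i).continuous
  have hR := (locallyLipschitz_coord (0 : Fin 4)).continuous
  exact ((((hR.add (hQ.const_mul _)).pow 2).add ((hQ.pow 2).div_const 2)).add
    ((henergy 1).const_mul _)).add ((henergy 2).const_mul _)

/-- The state with given values `v` of `(R + π₁ Q, Y, Z, Q)`, the coordinates in which the Lyapunov
function is a sum of powers of the absolute values of the coordinates. -/
noncomputable def stateOfLyapunovCoords (P : Params) (v : Fin 4 → ℝ) : EuclideanSpace ℝ (Fin 4) :=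
  !₂[v 0 - P.pi1 * v 3, v 1, v 2,
    v 3 - P.pi1 * (P.α * signedRpow P.p (v 1) + P.αc * signedRpow P.p (v 2))]

theorem continuous_stateOfLyapunovCoords (hp : 1 ≤ P.p) :
    Continuous (stateOfLyapunovCoords P) := by
  have hspring (i : Fin 4) : Continuous fun v : Fin 4 → ℝ => signedRpow P.p (v i) :=
    (continuous_signedRpow hp).comp (continuous_apply i)
  refine (PiLp.continuous_toLp 2 _).comp (continuous_pi fun i => ?_)
  fin_cases i
  · exact (continuous_apply 0).sub (continuous_const.mul (continuous_apply 3))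
  · exact continuous_apply 1
  · exact continuous_apply 2
  · exact (continuous_apply 3).sub (continuous_const.mul
      ((continuous_const.mul (hspring 1)).add (continuous_const.mul (hspring 2))))

theorem stateOfLyapunovCoords_eq (P : Params) (X : EuclideanSpace ℝ (Fin 4)) :
    stateOfLyapunovCoords P ![X 0 + P.pi1 * Q P X, X 1, X 2, Q P X] = X := by
  ext i
  fin_cases i <;> simp [stateOfLyapunovCoords, Q_eq, f₁_eq]

theorem isCompact_sublevel (hp : 1 ≤ P.p) (hα : 0 < P.α) (hαc : 0 < P.αc) (hA : 0 < P.A)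
    (X₀ : EuclideanSpace ℝ (Fin 4)) : IsCompact (sublevel P X₀) := by
  set c := lyapunov P X₀
  set a := P.α / (P.p + 1)
  set b := P.αc / ((P.p + 1) * P.A)
  have ha : 0 < a := by positivity
  have hb : 0 < b := by positivity
  set box : Fin 4 → Set ℝ := ![{s | 1 * |s| ^ (2 : ℝ) ≤ c}, {y | a * |y| ^ (P.p + 1) ≤ c},
    {z | b * |z| ^ (P.p + 1) ≤ c}, {q | 1 / 2 * |q| ^ (2 : ℝ) ≤ c}]
  have hbox : IsCompact (univ.pi box) := by
    have hexp : 0 < P.p + 1 := by linarith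
    refine isCompact_univ_pi fun i => ?_
    fin_cases i
    exacts [isCompact_setOf_mul_abs_rpow_le one_pos two_pos c,
      isCompact_setOf_mul_abs_rpow_le ha hexp c, isCompact_setOf_mul_abs_rpow_le hb hexp c,
      isCompact_setOf_mul_abs_rpow_le one_half_pos two_pos c]
  refine (hbox.image (continuous_stateOfLyapunovCoords hp)).of_isClosed_subset
    (isClosed_le (continuous_lyapunov hp) continuous_const) fun X hX =>
      ⟨_, fun i _ => ?_, stateOfLyapunovCoords_eq P X⟩
  have hsum : (X 0 + P.pi1 * Q P X) ^ 2 + Q P X ^ 2 / 2 + a * |X 1| ^ (P.p + 1)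
      + b * |X 2| ^ (P.p + 1) ≤ c := hX
  have hS := sq_nonneg (X 0 + P.pi1 * Q P X)
  have hQ := sq_nonneg (Q P X)
  have hY : 0 ≤ a * |X 1| ^ (P.p + 1) := by positivity
  have hZ : 0 ≤ b * |X 2| ^ (P.p + 1) := by positivity
  fin_cases i
  · change 1 * |X 0 + P.pi1 * Q P X| ^ (2 : ℝ) ≤ c
    rw [Real.rpow_two, sq_abs]
    linarith
  · change a * |X 1| ^ (P.p + 1) ≤ c
    linarith
  · change b * |X 2| ^ (P.p + 1) ≤ c
    linarith
  · change 1 / 2 * |Q P X| ^ (2 : ℝ) ≤ c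
    rw [Real.rpow_two, sq_abs]
    linarith

theorem signedRpow_mul_hysteresis_nonneg (hn : P.n ≠ 0) (hp : P.p ≠ 0) (hπ₃ : |P.pi3| ≤ P.pi2)
    (X : EuclideanSpace ℝ (Fin 4)) : 0 ≤ signedRpow P.p (X 2) * hysteresis P X := by
  have hsame : signedRpow P.p (X 2) * signedRpow P.n (X 2) = |X 2| ^ P.p * |X 2| ^ P.n := by
    rw [← abs_of_nonneg (signedRpow_mul_signedRpow_nonneg P.p P.n (X 2)), abs_mul,
      abs_signedRpow hp, abs_signedRpow hn]
  have hcross : |P.pi3 * (signedRpow P.p (X 2) * |X 2| ^ P.n * X 3)|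
      = |P.pi3| * (|X 2| ^ P.p * |X 2| ^ P.n * |X 3|) := by
    simp only [abs_mul, abs_signedRpow hp, abs_of_nonneg (Real.rpow_nonneg (abs_nonneg (X 2)) _)]
  calc 0 ≤ (P.pi2 - |P.pi3|) * (|X 2| ^ P.p * |X 2| ^ P.n * |X 3|) :=
        mul_nonneg (sub_nonneg.2 hπ₃) (by positivity)
    _ ≤ P.pi2 * (|X 2| ^ P.p * |X 2| ^ P.n * |X 3|)
        + P.pi3 * (signedRpow P.p (X 2) * |X 2| ^ P.n * X 3) := by
      linarith [neg_abs_le (P.pi3 * (signedRpow P.p (X 2) * |X 2| ^ P.n * X 3))]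
    _ = signedRpow P.p (X 2) * hysteresis P X := by
      rw [← hsame, hysteresis]
      ring

section Rate

variable (hπ₁ : 0 < P.pi1) (hπ₃ : |P.pi3| ≤ P.pi2) (hn : P.n ≠ 0) (hp : P.p ≠ 0)
  (hαc : 0 < P.αc)
include hπ₁ hπ₃ hn hp hαc

theorem lyapunovRate_nonpos (X : EuclideanSpace ℝ (Fin 4)) : lyapunovRate P X ≤ 0 := by
  have hspring : 0 ≤ f₁ P X ^ 2 / P.pi1 := by positivity
  have hhyst := mul_nonneg hαc.le (signedRpow_mul_hysteresis_nonneg hn hp hπ₃ X)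
  rw [lyapunovRate]
  linarith

theorem f₁_eq_zero_and_hysteresis_eq_zero {X : EuclideanSpace ℝ (Fin 4)}
    (hX : lyapunovRate P X = 0) : f₁ P X = 0 ∧ hysteresis P X = 0 := by
  have hspring : 0 ≤ f₁ P X ^ 2 / P.pi1 := by positivity
  have hhyst := mul_nonneg hαc.le (signedRpow_mul_hysteresis_nonneg hn hp hπ₃ X)
  rw [lyapunovRate] at hX
  constructor
  · have hsq : f₁ P X ^ 2 / P.pi1 = 0 := by linarith
    simpa [hπ₁.ne'] using hsq
  · have hprod : P.αc * (signedRpow P.p (X 2) * hysteresis P X) = 0 := by linarith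
    rcases mul_eq_zero.1 ((mul_eq_zero.1 hprod).resolve_left hαc.ne') with hZ | hh
    · have hZ' : X 2 = 0 := signedRpow_injective hp (by simpa [signedRpow] using hZ)
      simp [hysteresis, signedRpow, hZ', Real.zero_rpow hn]
    · exact hh

end Rate

section Solutions

variable {I : Set ℝ} {x : ℝ → EuclideanSpace ℝ (Fin 4)} {t : ℝ}

theorem IsSolutionOn.hasDerivWithinAt_apply {d : ℕ}
    {f : EuclideanSpace ℝ (Fin d) → EuclideanSpace ℝ (Fin d)} {x : ℝ → EuclideanSpace ℝ (Fin d)}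
    (hx : IsSolutionOn f I x) (ht : t ∈ I) (i : Fin d) :
    HasDerivWithinAt (fun s => x s i) (f (x t) i) I t :=
  (EuclideanSpace.proj (𝕜 := ℝ) i).hasFDerivAt.comp_hasDerivWithinAt t (hx t ht)

theorem IsSolutionOn.hasDerivWithinAt_Q (hp : 1 ≤ P.p) (hx : IsSolutionOn (stateFun P) I x)
    (ht : t ∈ I) : HasDerivWithinAt (fun s => Q P (x s)) (-(1 / P.pi1) * f₁ P (x t)) I t := by
  have hspring (i) := (hasDerivAt_signedRpow hp (x t i)).comp_hasDerivWithinAt t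
    (hx.hasDerivWithinAt_apply ht i)
  have hf₁ := (((hspring 1).const_mul P.α).add ((hspring 2).const_mul P.αc)).const_mul P.pi1
  have hsum := hf₁.add (hx.hasDerivWithinAt_apply ht 3)
  simp only [Q_eq, f₁_eq]
  refine hsum.congr_deriv ?_
  simp [stateFun, f₂, f₄_eq, f₁_eq]

theorem IsSolutionOn.hasDerivWithinAt_lyapunov (hπ₁ : P.pi1 ≠ 0) (hp : 1 ≤ P.p) (hA : P.A ≠ 0)
    (hx : IsSolutionOn (stateFun P) I x) (ht : t ∈ I) :
    HasDerivWithinAt (fun s => lyapunov P (x s)) (lyapunovRate P (x t)) I t := by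
  have hp1 : P.p + 1 ≠ 0 := by linarith
  have hR : HasDerivWithinAt (fun s => x s 0) (f₁ P (x t)) I t := hx.hasDerivWithinAt_apply ht 0
  have hQ := hx.hasDerivWithinAt_Q hp ht
  have henergy (i) := (hasDerivAt_abs_rpow_add_one (zero_lt_one.trans_le hp)
    (x t i)).comp_hasDerivWithinAt t (hx.hasDerivWithinAt_apply ht i)
  have hsum := ((((hR.add (hQ.const_mul P.pi1)).pow 2).add ((hQ.pow 2).div_const 2)).add
    ((henergy 1).const_mul (P.α / (P.p + 1)))).add
      ((henergy 2).const_mul (P.αc / ((P.p + 1) * P.A)))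
  refine hsum.congr_deriv ?_
  have hZ : stateFun P (x t) 2 = f₃ P (x t) := rfl
  have hY : stateFun P (x t) 1 = x t 3 := rfl
  rw [hZ, hY, lyapunovRate]
  simp only [Q_eq, f₃_eq, f₁_eq]
  field_simp
  simp only [Nat.cast_ofNat, Pi.add_apply, Nat.add_one_sub_one, pow_one]
  ring

theorem IsSolutionOn.antitoneOn_lyapunov (hπ₁ : 0 < P.pi1) (hπ₃ : |P.pi3| ≤ P.pi2)
    (hn : P.n ≠ 0) (hp : 1 ≤ P.p) (hαc : 0 < P.αc) (hA : P.A ≠ 0) (hI : Convex ℝ I)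
    (hx : IsSolutionOn (stateFun P) I x) : AntitoneOn (fun t => lyapunov P (x t)) I := by
  have hderiv (t) (ht : t ∈ I) := hx.hasDerivWithinAt_lyapunov hπ₁.ne' hp hA ht
  exact antitoneOn_of_hasDerivWithinAt_nonpos hI (fun t ht => (hderiv t ht).continuousWithinAt)
    (fun t ht => (hderiv t (interior_subset ht)).mono interior_subset)
    fun t _ => lyapunovRate_nonpos hπ₁ hπ₃ hn (zero_lt_one.trans_le hp).ne' hαc _

end Solutions

theorem apply_two_eq_of_f₁_eq_zero (hπ₁ : P.pi1 ≠ 0) (hp : P.p ≠ 0) (hα : 0 ≤ P.α) (hαc : 0 < P.αc)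
    {X : EuclideanSpace ℝ (Fin 4)} (hX : f₁ P X = 0) :
    X 2 = -(P.α / P.αc) ^ (1 / P.p) * X 1 := by
  have hratio : 0 ≤ P.α / P.αc := by positivity
  have hroot : signedRpow P.p ((P.α / P.αc) ^ (1 / P.p)) = P.α / P.αc := by
    rw [signedRpow_of_nonneg hp (by positivity), one_div, Real.rpow_inv_rpow hratio hp]
  have hforces : P.α * signedRpow P.p (X 1) + P.αc * signedRpow P.p (X 2) = 0 :=
    (mul_eq_zero.1 ((f₁_eq P X).symm.trans hX)).resolve_left hπ₁
  refine signedRpow_injective hp ?_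
  rw [signedRpow_mul, signedRpow_neg, hroot]
  field_simp
  linarith

theorem IsSolutionOn.mem_equilibria_of_lyapunov_const (hπ₁ : 0 < P.pi1) (hπ₃ : |P.pi3| ≤ P.pi2)
    (hn : P.n ≠ 0) (hp : 1 ≤ P.p) (hα : 0 ≤ P.α) (hαc : 0 < P.αc) (hA : 0 < P.A)
    {x : ℝ → EuclideanSpace ℝ (Fin 4)} (hx : IsSolutionOn (stateFun P) (Ici 0) x) {c : ℝ}
    (hc : ∀ t, 0 ≤ t → lyapunov P (x t) = c) {t : ℝ} (ht : 0 ≤ t) : x t ∈ equilibria P := by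
  have hp0 : P.p ≠ 0 := (zero_lt_one.trans_le hp).ne'
  have hrate {s : ℝ} (hs : 0 ≤ s) : lyapunovRate P (x s) = 0 :=
    (uniqueDiffOn_Ici 0 s hs).eq_deriv _ (hx.hasDerivWithinAt_lyapunov hπ₁.ne' hp hA.ne' hs)
      ((hasDerivWithinAt_const s (Ici 0) c).congr hc (hc s hs))
  have hstationary {s : ℝ} (hs : 0 ≤ s) :=
    f₁_eq_zero_and_hysteresis_eq_zero hπ₁ hπ₃ hn hp0 hαc (hrate hs)
  set k := (P.α / P.αc) ^ (1 / P.p)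
  have hbalance (s) (hs : 0 ≤ s) : x s 2 = -k * x s 1 :=
    apply_two_eq_of_f₁_eq_zero hπ₁.ne' hp0 hα hαc (hstationary hs).1
  have hW : x t 3 = 0 := by
    have hY : HasDerivWithinAt (fun s => x s 1) (x t 3) (Ici 0) t :=
      hx.hasDerivWithinAt_apply ht 1
    have hZ : HasDerivWithinAt (fun s => x s 2) (f₃ P (x t)) (Ici 0) t :=
      hx.hasDerivWithinAt_apply ht 2
    have hvelocity : f₃ P (x t) = -k * x t 3 :=
      (uniqueDiffOn_Ici 0 t ht).eq_deriv _ hZ ((hY.const_mul (-k)).congr hbalance (hbalance t ht))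
    rw [f₃_eq, (hstationary ht).2] at hvelocity
    have hAk : 0 < P.A + k := add_pos_of_pos_of_nonneg hA (by positivity)
    exact (mul_eq_zero.1 (by linear_combination hvelocity : (P.A + k) * x t 3 = 0)).resolve_left
      hAk.ne'
  refine ⟨x t 0, x t 1, ?_⟩
  ext i
  fin_cases i
  exacts [rfl, rfl, hbalance t ht, hW]

end Model

end BoucWenMaxwell

open BoucWenMaxwell

theorem mainTheorem4_general (P : Params) (hπ₁ : 0 < P.pi1) (hπ₃ : |P.pi3| ≤ P.pi2)
    (hn : 1 ≤ P.n) (hp : 2 ≤ P.p ∨ P.p = 1) (hα : P.α ∈ Ioo (0 : ℝ) 1) (hA : 0 < P.A)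
    (X : ℝ → EuclideanSpace ℝ (Fin 4)) (Y : EuclideanSpace ℝ (Fin 4))
    (hX : IsSolutionOn (stateFun P) (Ici 0) X) (hY : X 0 = Y) :
    (positiveLimitSet (stateFun P) Y).Nonempty ∧
    IsConnected (positiveLimitSet (stateFun P) Y) ∧
    IsInvariant (stateFun P) (positiveLimitSet (stateFun P) Y) ∧
    ConvergesToSet X (positiveLimitSet (stateFun P) Y) ∧
    positiveLimitSet (stateFun P) Y ⊆ sublevel P Y ∩ equilibria P := by
  subst hY
  have hp1 : 1 ≤ P.p := hp.elim one_le_two.trans Eq.ge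
  have hn0 : P.n ≠ 0 := (zero_lt_one.trans_le hn).ne'
  have hαc : 0 < P.αc := sub_pos.2 hα.2
  have hf := locallyLipschitz_stateFun hn hp
  have hV := hX.antitoneOn_lyapunov hπ₁ hπ₃ hn0 hp1 hαc hA.ne' (convex_Ici 0)
  have hK : IsCompact (sublevel P (X 0)) := isCompact_sublevel hp1 hα.1 hαc hA (X 0)
  have hXK : MapsTo X (Ici 0) (sublevel P (X 0)) := fun t ht => hV self_mem_Ici ht ht
  have hconn := isConnected_positiveLimitSet hf hX hK hXK
  refine ⟨hconn.nonempty, hconn, isInvariant_positiveLimitSet hf hX hK hXK,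
    convergesToSet_positiveLimitSet hf hX hK hXK,
    subset_inter (positiveLimitSet_subset hf hX hK.isClosed hXK) fun q hq => ?_⟩
  obtain ⟨y, hy, rfl, hVy⟩ :=
    exists_solution_const_of_antitoneOn hf hX hK hXK (continuous_lyapunov hp1) hV hq
  exact hy.mem_equilibria_of_lyapunov_const hπ₁ hπ₃ hn0 hp1 hα.1.le hαc hA hVy le_rfl

theorem mainTheorem4 (P : BoucWenMaxwell.Params) (hP : P.Admissible)
    (X : ℝ → EuclideanSpace ℝ (Fin 4)) (Y : EuclideanSpace ℝ (Fin 4))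
    (hX : BoucWenMaxwell.IsSolutionOn (BoucWenMaxwell.stateFun P) (Set.Ici 0) X)
    (hY : X 0 = Y) :
    (BoucWenMaxwell.positiveLimitSet (BoucWenMaxwell.stateFun P) Y).Nonempty ∧
    IsConnected (BoucWenMaxwell.positiveLimitSet (BoucWenMaxwell.stateFun P) Y) ∧
    BoucWenMaxwell.IsInvariant (BoucWenMaxwell.stateFun P)
      (BoucWenMaxwell.positiveLimitSet (BoucWenMaxwell.stateFun P) Y) ∧
    BoucWenMaxwell.ConvergesToSet X
      (BoucWenMaxwell.positiveLimitSet (BoucWenMaxwell.stateFun P) Y) ∧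
    BoucWenMaxwell.positiveLimitSet (BoucWenMaxwell.stateFun P) Y ⊆
      BoucWenMaxwell.sublevel P Y ∩ BoucWenMaxwell.equilibria P :=
  mainTheorem4_general P hP.pi1_pos (abs_lt.2 hP.pi3_mem).le hP.one_le_n hP.p_cond hP.α_mem hP.A_pos
    X Y hX hY
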